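/- For $n\in\mathbb{Z}$ let $J_n(x)=\frac{1}{2\pi}\int_0^{2\pi}e^{\imath x\sin\theta}e^{-\imath n\theta}\,d\theta$ be the Bessel function of the first kind of order $n$, and for an integer $k\ge 1$ let $\lambda_{nk}$ be the $k$-th smallest positive root of $J_n$. Put $$c_{nk}=\frac{1}{\sqrt{\pi}\,|J_{n+1}(\lambda_{nk})|},\qquad \psi_{nk}(r,\theta)=c_{nk}\,J_n(\lambda_{nk}r)\,e^{\imath n\theta}\,\chi_{[0,1)}(r),$$ where $(r,\theta)$ are polar coordinates on $\mathbb{R}^2$ and $\chi_{[0,1)}$ is the indicator function of $[0,1)$. Then for all $n\in\mathbb{Z}$ and all integers $k\ge 1$: the $c_{nk}$ are the constants that normalize the $\psi_{nk}$, that is, $\|\psi_{nk}\|_{L^2(\mathbb{R}^2)}=1$; moreover $J_n'(\lambda_{nk})\ne 0$ and $$c_{nk}=\frac{1}{\sqrt{\pi}\,|J_n'(\lambda_{nk})|};$$ and for every integer $p\ge 0$, if $\lambda_{nk}\le\sqrt{\pi p}$, then $|c_{nk}|\le\sqrt{2p}$. -/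

import Mathlib

open MeasureTheory

noncomputable section

/-- The Bessel function of the first kind `J_n` of integer order `n`, on the real line, given by
Bessel's integral `J_n(x) = (1 / 2π) ∫₀^{2π} e^{i x sin θ} e^{-i n θ} dθ`. The imaginary part of
this integral vanishes (substitute `θ ↦ 2π - θ`), so that the integrand may be replaced by its
real part `cos (x sin θ - n θ)`. -/
def besselJ (n : ℤ) (x : ℝ) : ℝ :=
  (2 * Real.pi)⁻¹ * ∫ θ in (0 : ℝ)..(2 * Real.pi), Real.cos (x * Real.sin θ - n * θ)

/-- For `k ≥ 1`, `besselRoot n k` is `λ_{nk}`, the `k`-th smallest positive root of `J_n`: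
the first root is the smallest root greater than `0`, and the `(k + 1)`-st one is the smallest root
greater than the `k`-th one. The value `0` at `k = 0` only starts the recursion. -/
def besselRoot (n : ℤ) : ℕ → ℝ
  | 0 => 0
  | k + 1 => sInf {x : ℝ | besselRoot n k < x ∧ besselJ n x = 0}

/-- The normalization constant `c_{nk} = 1 / (π^{1/2} |J_{n+1}(λ_{nk})|)`. -/
def normConst (n : ℤ) (k : ℕ) : ℝ :=
  1 / (√Real.pi * |besselJ (n + 1) (besselRoot n k)|)

/-- The disk harmonic `ψ_{nk}(r, θ) = c_{nk} J_n(λ_{nk} r) e^{i n θ} χ_{[0,1)}(r)`, as a function on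
the plane, which is identified with `ℂ` through `z = r e^{i θ}`. -/
def diskHarmonic (n : ℤ) (k : ℕ) : ℂ → ℂ :=
  (Metric.ball (0 : ℂ) 1).indicator fun z =>
    (normConst n k : ℂ) * (besselJ n (besselRoot n k * ‖z‖) : ℂ) *
      Complex.exp (Complex.I * n * z.arg)

end

/-!
The recurrences `x J_n' = n J_n - x J_{n+1}` and `x J_{n+1}' = x J_n - (n + 1) J_{n+1}`, obtained
from Bessel's integral, give `J_n'(λ) = -J_{n+1}(λ)` at a positive root `λ` of `J_n`. They also show
that the energy
`E_n(x) = x² (J_n² + J_{n+1}²) / 2 - n x J_n J_{n+1}`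
has derivative `x J_n(x)²` (`hasDerivAt_besselEnergy`) and the value `λ² J_{n+1}(λ)² / 2` at a root.
Hence `∫₀¹ J_n(λ r)² r dr = J_{n+1}(λ)² / 2`, and integration in polar coordinates yields the
normalization (`lintegral_sq_diskHarmonic`).

The bound on the constants amounts to `λ² J_n'(λ)² ≥ 1 / 2`, that is, `E_n(λ) ≥ 1 / 4`, at every
positive root, which also shows that the roots are simple. For `n = 0` it follows from
`J_0(x) ≥ 1 - x² / 4`. To pass from `n` to `n + 1`, note that `E_{n+1}(μ) = E_n(μ)` at a root `μ` of
`J_n` (`besselEnergy_succ_of_root`), that every positive root of `J_{n+1}` exceeds some positive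
root of `J_n` (Rolle's theorem for `x^{n+1} J_{n+1}`), and that `E_{n+1}` is nondecreasing. Negative
orders are reduced to positive ones by `J_{-n} = (-1)^n J_n`.

It remains to see that `besselRoot n k` really is a root for `k ≥ 1`, i.e. that the infimum in its
definition is taken over a nonempty set and attained. Roots are unbounded: for `J_0` by Sturm
comparison of `√x J_0` with a sine (`exists_root_besselJ_zero`), and for higher orders by Rolle's
theorem for `J_n / x^n`. The infimum is attained because roots are isolated, and there is none in
`(0, 1]`, by the same induction that bounds the energy.
-/

/-! ### Derivatives and recurrences -/

theorem continuous_besselJ_integrand (n : ℤ) (x : ℝ) :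
    Continuous fun θ : ℝ => Real.cos (x * Real.sin θ - n * θ) := by
  fun_prop

theorem intervalIntegrable_besselJ_integrand (n : ℤ) (x : ℝ) :
    IntervalIntegrable (fun θ : ℝ => Real.cos (x * Real.sin θ - n * θ)) volume 0
      (2 * Real.pi) :=
  (continuous_besselJ_integrand n x).intervalIntegrable _ _

theorem integral_besselJ_integrand (n : ℤ) (x : ℝ) :
    ∫ θ in (0 : ℝ)..(2 * Real.pi), Real.cos (x * Real.sin θ - n * θ) =
      2 * Real.pi * besselJ n x := by
  have := Real.pi_pos
  rw [besselJ]
  field_simp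

theorem besselJ_integrand_add (n : ℤ) (x θ : ℝ) :
    Real.cos (x * Real.sin θ - (n - 1 : ℤ) * θ) + Real.cos (x * Real.sin θ - (n + 1 : ℤ) * θ) =
      2 * (Real.cos θ * Real.cos (x * Real.sin θ - n * θ)) := by
  have h₁ : x * Real.sin θ - (n - 1 : ℤ) * θ = (x * Real.sin θ - n * θ) + θ := by
    push_cast; ring
  have h₂ : x * Real.sin θ - (n + 1 : ℤ) * θ = (x * Real.sin θ - n * θ) - θ := by
    push_cast; ring
  rw [h₁, h₂, Real.cos_add _ θ, Real.cos_sub _ θ]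
  ring

theorem besselJ_integrand_sub (n : ℤ) (x θ : ℝ) :
    Real.cos (x * Real.sin θ - (n - 1 : ℤ) * θ) - Real.cos (x * Real.sin θ - (n + 1 : ℤ) * θ) =
      2 * (-Real.sin (x * Real.sin θ - n * θ) * Real.sin θ) := by
  have h₁ : x * Real.sin θ - (n - 1 : ℤ) * θ = (x * Real.sin θ - n * θ) + θ := by
    push_cast; ring
  have h₂ : x * Real.sin θ - (n + 1 : ℤ) * θ = (x * Real.sin θ - n * θ) - θ := by
    push_cast; ring
  rw [h₁, h₂, Real.cos_add _ θ, Real.cos_sub _ θ]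
  ring

theorem hasDerivAt_besselJ (n : ℤ) (x : ℝ) :
    HasDerivAt (besselJ n) ((besselJ (n - 1) x - besselJ (n + 1) x) / 2) x := by
  have key := (intervalIntegral.hasDerivAt_integral_of_dominated_loc_of_deriv_le
    (μ := volume) (a := 0) (b := 2 * Real.pi) (x₀ := x) (s := Set.univ) (bound := fun _ => 1)
    (F := fun x θ : ℝ => Real.cos (x * Real.sin θ - n * θ))
    (F' := fun x θ : ℝ => -Real.sin (x * Real.sin θ - n * θ) * Real.sin θ)
    Filter.univ_mem
    (Filter.Eventually.of_forall fun y =>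
      (continuous_besselJ_integrand n y).aestronglyMeasurable)
    (intervalIntegrable_besselJ_integrand n x)
    (Continuous.aestronglyMeasurable (by fun_prop))
    (Filter.Eventually.of_forall fun θ _ y _ => by
      rw [norm_mul, norm_neg, Real.norm_eq_abs, Real.norm_eq_abs]
      exact mul_le_one₀ (Real.abs_sin_le_one _) (abs_nonneg _) (Real.abs_sin_le_one _))
    intervalIntegrable_const
    (Filter.Eventually.of_forall fun θ _ y _ => by
      have h := (((hasDerivAt_id y).mul_const (Real.sin θ)).sub_const (n * θ)).cos
      simpa using h)).2
  have h := key.const_mul (2 * Real.pi)⁻¹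
  have e : (2 * Real.pi)⁻¹ * (∫ θ in (0 : ℝ)..(2 * Real.pi),
      -Real.sin (x * Real.sin θ - n * θ) * Real.sin θ) =
      (besselJ (n - 1) x - besselJ (n + 1) x) / 2 := by
    rw [besselJ, besselJ, ← mul_sub, ← intervalIntegral.integral_sub
      (intervalIntegrable_besselJ_integrand _ x) (intervalIntegrable_besselJ_integrand _ x)]
    simp_rw [besselJ_integrand_sub]
    rw [intervalIntegral.integral_const_mul]
    ring
  rw [e] at h
  exact h

/-- The three-term recurrence: the integrand of the difference of the two sides is the
`θ`-derivative of the periodic function `sin (x sin θ - n θ)`. -/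
theorem mul_besselJ_add_besselJ (n : ℤ) (x : ℝ) :
    x * (besselJ (n - 1) x + besselJ (n + 1) x) = 2 * n * besselJ n x := by
  have hd : ∀ θ ∈ Set.uIcc 0 (2 * Real.pi),
      HasDerivAt (fun θ : ℝ => Real.sin (x * Real.sin θ - n * θ))
        (x / 2 * (Real.cos (x * Real.sin θ - (n - 1 : ℤ) * θ) +
          Real.cos (x * Real.sin θ - (n + 1 : ℤ) * θ)) -
            n * Real.cos (x * Real.sin θ - n * θ)) θ := by
    intro θ _
    have h := (((Real.hasDerivAt_sin θ).const_mul x).sub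
      ((hasDerivAt_id θ).const_mul (n : ℝ))).sin
    refine h.congr_deriv ?_
    rw [besselJ_integrand_add]
    simp only [Pi.sub_apply, id]
    ring
  have i₁ := intervalIntegrable_besselJ_integrand (n - 1) x
  have i₂ := intervalIntegrable_besselJ_integrand (n + 1) x
  have i₀ := intervalIntegrable_besselJ_integrand n x
  have key := intervalIntegral.integral_eq_sub_of_hasDerivAt hd
    (((i₁.add i₂).const_mul _).sub (i₀.const_mul _))
  have hs : Real.sin (x * Real.sin (2 * Real.pi) - n * (2 * Real.pi)) = 0 := by
    rw [Real.sin_two_pi, mul_zero, zero_sub, Real.sin_neg, neg_eq_zero]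
    convert Real.sin_int_mul_pi (n * 2) using 2
    push_cast; ring
  rw [intervalIntegral.integral_sub ((i₁.add i₂).const_mul _) (i₀.const_mul _),
    intervalIntegral.integral_const_mul, intervalIntegral.integral_const_mul,
    intervalIntegral.integral_add i₁ i₂, hs, integral_besselJ_integrand,
    integral_besselJ_integrand, integral_besselJ_integrand] at key
  simp only [Real.sin_zero, mul_zero, sub_zero] at key
  have := Real.pi_pos
  have hk : Real.pi * (x * (besselJ (n - 1) x + besselJ (n + 1) x)) =
      Real.pi * (2 * n * besselJ n x) := by linear_combination key
  exact mul_left_cancel₀ this.ne' hk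

theorem differentiable_besselJ (n : ℤ) : Differentiable ℝ (besselJ n) := fun x =>
  (hasDerivAt_besselJ n x).differentiableAt

theorem continuous_besselJ (n : ℤ) : Continuous (besselJ n) :=
  (differentiable_besselJ n).continuous

theorem mul_deriv_besselJ (n : ℤ) (x : ℝ) :
    x * deriv (besselJ n) x = n * besselJ n x - x * besselJ (n + 1) x := by
  rw [(hasDerivAt_besselJ n x).deriv]
  linear_combination mul_besselJ_add_besselJ n x / 2

theorem mul_deriv_besselJ_succ (n : ℤ) (x : ℝ) :
    x * deriv (besselJ (n + 1)) x = x * besselJ n x - (n + 1) * besselJ (n + 1) x := by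
  have h := mul_besselJ_add_besselJ (n + 1) x
  rw [(hasDerivAt_besselJ (n + 1) x).deriv]
  rw [add_sub_cancel_right] at h ⊢
  push_cast at h
  linear_combination -h / 2

theorem deriv_besselJ_of_root {n : ℤ} {x : ℝ} (hx : x ≠ 0) (h : besselJ n x = 0) :
    deriv (besselJ n) x = -besselJ (n + 1) x := by
  have := mul_deriv_besselJ n x
  rw [h, mul_zero, zero_sub, ← mul_neg] at this
  exact mul_left_cancel₀ hx this

theorem besselJ_add_two_of_root {n : ℤ} {x : ℝ} (h : besselJ n x = 0) :
    x * besselJ (n + 2) x = 2 * (n + 1) * besselJ (n + 1) x := by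
  have := mul_besselJ_add_besselJ (n + 1) x
  rw [add_sub_cancel_right, h, zero_add, show n + 1 + 1 = n + 2 by ring] at this
  push_cast at this
  exact this

/-- The reflection `J_{-n} = (-1)ⁿ J_n`, from the substitution `θ ↦ π - θ` and periodicity. -/
theorem besselJ_neg (n : ℤ) (x : ℝ) : besselJ (-n) x = (-1) ^ n * besselJ n x := by
  have hp : Function.Periodic (fun θ : ℝ => Real.cos (x * Real.sin θ - n * θ)) (2 * Real.pi) := by
    intro θ
    have e : x * Real.sin (θ + 2 * Real.pi) - n * (θ + 2 * Real.pi) =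
        (x * Real.sin θ - n * θ) - n * (2 * Real.pi) := by
      rw [Real.sin_add_two_pi]; ring
    simp only [e]
    exact Real.cos_sub_int_mul_two_pi _ _
  have e : ∀ θ : ℝ, Real.cos (x * Real.sin θ - (-n : ℤ) * θ) =
      (-1) ^ n * Real.cos (x * Real.sin (Real.pi - θ) - n * (Real.pi - θ)) := by
    intro θ
    rw [Real.sin_pi_sub, ← Real.cos_add_int_mul_pi]
    congr 1
    push_cast; ring
  rw [besselJ, besselJ]
  simp_rw [e]
  rw [intervalIntegral.integral_const_mul, intervalIntegral.integral_comp_sub_left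
    (fun θ : ℝ => Real.cos (x * Real.sin θ - n * θ))]
  have := hp.intervalIntegral_add_eq (Real.pi - 2 * Real.pi) 0
  rw [sub_add_cancel, zero_add] at this
  rw [sub_zero, this]
  ring

/-! ### The energy function -/

/-- The function `E_n(x) = x² (J_n² + J_{n+1}²) / 2 - n x J_n J_{n+1}`, which is the primitive
`∫₀ˣ t J_n(t)² dt` in closed form. -/
noncomputable def besselEnergy (n : ℤ) (x : ℝ) : ℝ :=
  x ^ 2 * (besselJ n x ^ 2 + besselJ (n + 1) x ^ 2) / 2 - n * x * besselJ n x * besselJ (n + 1) x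

theorem hasDerivAt_besselEnergy (n : ℤ) (x : ℝ) :
    HasDerivAt (besselEnergy n) (x * besselJ n x ^ 2) x := by
  have h₀ := (differentiable_besselJ n x).hasDerivAt
  have h₁ := (differentiable_besselJ (n + 1) x).hasDerivAt
  have h := ((((hasDerivAt_id x).pow 2).mul ((h₀.pow 2).add (h₁.pow 2))).div_const 2).sub
    ((((hasDerivAt_id x).const_mul (n : ℝ)).mul h₀).mul h₁)
  refine h.congr_deriv ?_
  simp
  linear_combination (x * besselJ n x - n * besselJ (n + 1) x) * mul_deriv_besselJ n x +
    (x * besselJ (n + 1) x - n * besselJ n x) * mul_deriv_besselJ_succ n x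

theorem besselEnergy_zero (n : ℤ) : besselEnergy n 0 = 0 := by
  simp [besselEnergy]

theorem monotoneOn_besselEnergy (n : ℤ) : MonotoneOn (besselEnergy n) (Set.Ici 0) := by
  have hd : Differentiable ℝ (besselEnergy n) := fun x =>
    (hasDerivAt_besselEnergy n x).differentiableAt
  refine monotoneOn_of_deriv_nonneg (convex_Ici 0) hd.continuous.continuousOn
    hd.differentiableOn fun x hx => ?_
  rw [interior_Ici] at hx
  rw [(hasDerivAt_besselEnergy n x).deriv]
  exact mul_nonneg hx.le (sq_nonneg _)

theorem besselEnergy_of_root {n : ℤ} {x : ℝ} (h : besselJ n x = 0) :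
    besselEnergy n x = x ^ 2 * besselJ (n + 1) x ^ 2 / 2 := by
  simp [besselEnergy, h]

/-- Consecutive energy functions agree at the roots of the Bessel function of lower order. -/
theorem besselEnergy_succ_of_root {n : ℤ} {x : ℝ} (h : besselJ n x = 0) :
    besselEnergy (n + 1) x = besselEnergy n x := by
  have h₂ := besselJ_add_two_of_root h
  rw [besselEnergy_of_root h, besselEnergy, show n + 1 + 1 = n + 2 by ring]
  push_cast
  linear_combination (x * besselJ (n + 2) x / 2) * h₂

/-! ### The function `J₀` on `[0, 1]` -/

theorem one_sub_sq_div_four_le_besselJ_zero (x : ℝ) : 1 - x ^ 2 / 4 ≤ besselJ 0 x := by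
  have hpi := Real.pi_pos
  have hm : ∫ θ in (0 : ℝ)..(2 * Real.pi), (1 - x ^ 2 / 2 * Real.sin θ ^ 2) ≤
      ∫ θ in (0 : ℝ)..(2 * Real.pi), Real.cos (x * Real.sin θ - (0 : ℤ) * θ) := by
    refine intervalIntegral.integral_mono_on (by positivity)
      (Continuous.intervalIntegrable (by fun_prop) _ _)
      (intervalIntegrable_besselJ_integrand 0 x) fun θ _ => ?_
    have := Real.one_sub_sq_div_two_le_cos (x := x * Real.sin θ)
    simp only [Int.cast_zero, zero_mul, sub_zero]
    linarith [mul_pow x (Real.sin θ) 2]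
  rw [integral_besselJ_integrand, intervalIntegral.integral_sub (by simp)
    (Continuous.intervalIntegrable (by fun_prop) _ _), intervalIntegral.integral_const_mul,
    integral_sin_sq] at hm
  simp at hm
  refine le_of_mul_le_mul_left ?_ (mul_pos two_pos hpi)
  linarith

/-- On `[0, 1]` one has `J₀ ≥ 3 / 4`, so that the derivative `x J₀²` of the energy is at least
`9 x / 16`, and `9 / 32 ≥ 1 / 4`. -/
theorem one_fourth_le_besselEnergy_zero_one : 1 / 4 ≤ besselEnergy 0 1 := by
  have hd : ∀ x : ℝ, HasDerivAt (fun x => besselEnergy 0 x - 9 / 32 * x ^ 2)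
      (x * besselJ 0 x ^ 2 - 9 / 16 * x) x := fun x => by
    refine ((hasDerivAt_besselEnergy 0 x).sub
      (((hasDerivAt_id x).pow 2).const_mul (9 / 32 : ℝ))).congr_deriv ?_
    simp
    ring
  have hm : MonotoneOn (fun x => besselEnergy 0 x - 9 / 32 * x ^ 2) (Set.Icc 0 1) := by
    refine monotoneOn_of_deriv_nonneg (convex_Icc 0 1)
      (fun x _ => (hd x).continuousAt.continuousWithinAt)
      (fun x _ => (hd x).differentiableAt.differentiableWithinAt) fun x hx => ?_
    rw [interior_Icc] at hx
    rw [(hd x).deriv]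
    have h := one_sub_sq_div_four_le_besselJ_zero x
    have h' : 3 / 4 ≤ besselJ 0 x := by nlinarith [hx.1, hx.2]
    nlinarith [hx.1, mul_nonneg hx.1.le (show 0 ≤ besselJ 0 x ^ 2 - 9 / 16 by nlinarith)]
  have := hm (by simp : (0 : ℝ) ∈ Set.Icc (0 : ℝ) 1) (by simp : (1 : ℝ) ∈ Set.Icc (0 : ℝ) 1)
    zero_le_one
  simp only [besselEnergy_zero] at this
  linarith

/-! ### Lower bounds at the positive roots -/

/-- Rolle's theorem for `x ^ (m + 1) * J_{m + 1}`, whose derivative is `x ^ (m + 1) * J_m`. -/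
theorem exists_root_besselJ_lt (m : ℕ) {x : ℝ} (hx : 0 < x) (h : besselJ (m + 1) x = 0) :
    ∃ y, 0 < y ∧ y < x ∧ besselJ m y = 0 := by
  obtain ⟨y, hy, h0⟩ := exists_hasDerivAt_eq_zero
    (f := fun t => t ^ (m + 1) * besselJ (m + 1) t) (f' := fun t => t ^ (m + 1) * besselJ m t) hx
    (Continuous.continuousOn ((continuous_pow _).mul (continuous_besselJ _)))
    (by simp [h]) fun t _ => by
      refine ((hasDerivAt_pow (m + 1) t).mul
        (differentiable_besselJ (m + 1) t).hasDerivAt).congr_deriv ?_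
      have := mul_deriv_besselJ_succ m t
      push_cast at this ⊢
      linear_combination t ^ m * this
  exact ⟨y, hy.1, hy.2, (mul_eq_zero.1 h0).resolve_left (pow_ne_zero _ hy.1.ne')⟩

/-- The energy of order `m` at the positive roots of `J_m` is bounded below by induction on `m`.
Below a root `x` of `J_{m + 1}` there is a root `y` of `J_m`, and
`E_{m + 1}(x) ≥ E_{m + 1}(y) = E_m(y)`. -/
theorem one_lt_and_one_fourth_le_besselEnergy_of_root_nat (m : ℕ) {x : ℝ} (hx : 0 < x)
    (h : besselJ m x = 0) : 1 < x ∧ 1 / 4 ≤ besselEnergy m x := by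
  induction m generalizing x with
  | zero =>
    have h1 : 1 < x := by
      have := one_sub_sq_div_four_le_besselJ_zero x
      rw [Nat.cast_zero] at h
      rw [h] at this
      nlinarith
    exact ⟨h1, one_fourth_le_besselEnergy_zero_one.trans
      (monotoneOn_besselEnergy 0 (zero_le_one' ℝ) hx.le h1.le)⟩
  | succ m ih =>
    push_cast at h ⊢
    obtain ⟨y, hy, hyx, h0⟩ := exists_root_besselJ_lt m hx h
    obtain ⟨h1, h2⟩ := ih hy h0
    rw [← besselEnergy_succ_of_root h0] at h2
    exact ⟨h1.trans hyx, h2.trans (monotoneOn_besselEnergy _ hy.le hx.le hyx.le)⟩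

theorem besselJ_neg_eq_zero_iff (n : ℤ) (x : ℝ) : besselJ (-n) x = 0 ↔ besselJ n x = 0 := by
  rw [besselJ_neg, mul_eq_zero, or_iff_right (zpow_ne_zero _ (by norm_num))]

theorem sq_deriv_besselJ_neg (n : ℤ) (x : ℝ) :
    deriv (besselJ (-n)) x ^ 2 = deriv (besselJ n) x ^ 2 := by
  have : besselJ (-n) = fun y => (-1) ^ n * besselJ n y := funext (besselJ_neg n)
  rw [this, deriv_const_mul_field, mul_pow, ← zpow_natCast, ← zpow_mul, mul_comm, mul_comm n,
    zpow_mul]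
  simp

/-- At a root, `2 E_n(x) = x² J_n'(x)²`; negative orders reduce to positive ones by reflection. In
particular the positive roots of `J_n` are simple and stay away from `0`. -/
theorem one_lt_and_half_le_of_root (n : ℤ) {x : ℝ} (hx : 0 < x) (h : besselJ n x = 0) :
    1 < x ∧ 1 / 2 ≤ x ^ 2 * deriv (besselJ n) x ^ 2 := by
  have key : ∀ m : ℕ, besselJ m x = 0 →
      1 < x ∧ 1 / 2 ≤ x ^ 2 * deriv (besselJ m) x ^ 2 := by
    intro m hm
    obtain ⟨h1, h2⟩ := one_lt_and_one_fourth_le_besselEnergy_of_root_nat m hx hm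
    rw [besselEnergy_of_root hm] at h2
    rw [deriv_besselJ_of_root hx.ne' hm, neg_sq]
    exact ⟨h1, by linarith⟩
  obtain ⟨m, rfl | rfl⟩ := n.eq_nat_or_neg
  · exact key m h
  · rw [sq_deriv_besselJ_neg]
    exact key m ((besselJ_neg_eq_zero_iff _ _).1 h)

theorem one_lt_of_root {n : ℤ} {x : ℝ} (hx : 0 < x) (h : besselJ n x = 0) : 1 < x :=
  (one_lt_and_half_le_of_root n hx h).1

theorem half_le_sq_mul_sq_deriv_of_root {n : ℤ} {x : ℝ} (hx : 0 < x) (h : besselJ n x = 0) :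
    1 / 2 ≤ x ^ 2 * deriv (besselJ n) x ^ 2 :=
  (one_lt_and_half_le_of_root n hx h).2

theorem deriv_besselJ_ne_zero_of_root {n : ℤ} {x : ℝ} (hx : 0 < x) (h : besselJ n x = 0) :
    deriv (besselJ n) x ≠ 0 := by
  intro h0
  have := half_le_sq_mul_sq_deriv_of_root hx h
  rw [h0] at this
  norm_num at this

/-! ### Oscillation -/

/-- Sturm comparison with `sin (x - c)`: the Wronskian
`W = √x (J₀ cos (x - c) + (J₁ - J₀ / (2 x)) sin (x - c))` of `√x J₀` and `sin (x - c)` has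
derivative `√x J₀ sin (x - c) / (4 x²)`. -/
theorem hasDerivAt_sturm_wronskian (c : ℝ) {x : ℝ} (hx : 0 < x) :
    HasDerivAt (fun x => √x * (besselJ 0 x * Real.cos (x - c) +
        (besselJ 1 x - besselJ 0 x / (2 * x)) * Real.sin (x - c)))
      (√x * besselJ 0 x * Real.sin (x - c) / (4 * x ^ 2)) x := by
  have h₀ := (differentiable_besselJ 0 x).hasDerivAt
  have h₁ := (differentiable_besselJ 1 x).hasDerivAt
  have d₀ : deriv (besselJ 0) x = -besselJ 1 x := by
    have := mul_deriv_besselJ 0 x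
    simp only [Int.cast_zero, zero_mul, zero_sub, zero_add] at this
    exact mul_left_cancel₀ hx.ne' (by linarith)
  have d₁ : deriv (besselJ 1) x = besselJ 0 x - besselJ 1 x / x := by
    have := mul_deriv_besselJ_succ 0 x
    simp only [Int.cast_zero, zero_add, one_mul] at this
    field_simp
    linarith
  rw [d₀] at h₀
  rw [d₁] at h₁
  have hc := ((hasDerivAt_id x).sub_const c).cos
  have hs := ((hasDerivAt_id x).sub_const c).sin
  have h2 := (hasDerivAt_id x).const_mul (2 : ℝ)
  have h := ((hasDerivAt_id x).sqrt hx.ne').mul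
    ((h₀.mul hc).add ((h₁.sub (h₀.div h2 (by simpa using hx.ne'))).mul hs))
  refine h.congr_deriv ?_
  simp only [id, Pi.sub_apply, Pi.add_apply, Pi.mul_apply, Pi.div_apply]
  have hq : √x ≠ 0 := (Real.sqrt_pos.2 hx).ne'
  have hqq : √x ^ 2 = x := Real.sq_sqrt hx.le
  have hinv : 1 / (2 * √x) = √x / (2 * x) := by
    field_simp
    exact hqq.symm
  rw [hinv]
  field_simp
  ring

/-- `J₀` has a zero in every interval of length `π` on the positive half-line. -/
theorem exists_root_besselJ_zero {c : ℝ} (hc : 0 < c) :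
    ∃ x ∈ Set.Icc c (c + Real.pi), besselJ 0 x = 0 := by
  by_contra! hne
  have hpi := Real.pi_pos
  have hle : c ≤ c + Real.pi := by linarith
  -- Without a zero, `J₀` keeps the sign of `J₀ c`; multiplying by `J₀ c` covers both signs.
  have hsame : ∀ x ∈ Set.Icc c (c + Real.pi), 0 < besselJ 0 c * besselJ 0 x := by
    intro x hx
    by_contra! hneg
    have hcont : ContinuousOn (fun t => besselJ 0 c * besselJ 0 t) (Set.Icc c x) :=
      (continuous_const.mul (continuous_besselJ 0)).continuousOn
    obtain ⟨y, hy, h0⟩ := intermediate_value_Icc' hx.1 hcont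
      ⟨hneg, mul_self_nonneg (besselJ 0 c)⟩
    exact (mul_ne_zero (hne c ⟨le_rfl, hle⟩) (hne y ⟨hy.1, hy.2.trans hx.2⟩)) h0
  have hpos : ∀ x ∈ Set.Icc c (c + Real.pi), 0 < x := fun x hx => hc.trans_le hx.1
  have hd := fun x (hx : x ∈ Set.Icc c (c + Real.pi)) =>
    (hasDerivAt_sturm_wronskian c (hpos x hx)).const_mul (besselJ 0 c)
  have hm := monotoneOn_of_deriv_nonneg (convex_Icc c (c + Real.pi))
    (fun x hx => (hd x hx).continuousAt.continuousWithinAt)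
    (fun x hx => (hd x (interior_subset hx)).differentiableAt.differentiableWithinAt)
    (fun x hx => by
      have hx' := interior_subset hx
      rw [(hd x hx').deriv]
      have hs : 0 ≤ Real.sin (x - c) :=
        Real.sin_nonneg_of_nonneg_of_le_pi (by linarith [hx'.1]) (by linarith [hx'.2])
      have e : besselJ 0 c * (√x * besselJ 0 x * Real.sin (x - c) / (4 * x ^ 2)) =
          (besselJ 0 c * besselJ 0 x) * (√x * Real.sin (x - c) / (4 * x ^ 2)) := by ring
      rw [e]
      exact mul_nonneg (hsame x hx').le (by positivity))
  -- The Wronskian is nondecreasing, but goes from `√c J₀(c)` to `-√(c + π) J₀(c + π)`.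
  have h := hm (Set.left_mem_Icc.2 hle) (Set.right_mem_Icc.2 hle) hle
  simp only [sub_self, Real.cos_zero, Real.sin_zero, add_sub_cancel_left, Real.cos_pi,
    Real.sin_pi, mul_zero, add_zero, mul_one] at h
  have h₁ := mul_pos (Real.sqrt_pos.2 hc) (hsame c (Set.left_mem_Icc.2 hle))
  have h₂ := mul_pos (Real.sqrt_pos.2 (hc.trans_le hle)) (hsame _ (Set.right_mem_Icc.2 hle))
  nlinarith

/-- Between two positive roots of `J_m` lies one of `J_{m + 1}`, by Rolle's theorem for
`J_m / x ^ m`, whose derivative is `-J_{m + 1} / x ^ m`. -/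
theorem exists_root_besselJ_succ_between (m : ℕ) {x y : ℝ} (hx : 0 < x) (hxy : x < y)
    (h₁ : besselJ m x = 0) (h₂ : besselJ m y = 0) :
    ∃ z, x < z ∧ z < y ∧ besselJ (m + 1) z = 0 := by
  have hd : ∀ t : ℝ, 0 < t →
      HasDerivAt (fun t => besselJ m t / t ^ m) (-besselJ (m + 1) t / t ^ m) t := by
    intro t ht
    refine ((differentiable_besselJ m t).hasDerivAt.div (hasDerivAt_pow m t)
      (pow_ne_zero _ ht.ne')).congr_deriv ?_
    have := mul_deriv_besselJ m t
    have hp : (m : ℝ) * t ^ (m - 1) * t = m * t ^ m := by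
      cases m with
      | zero => simp
      | succ m => rw [Nat.add_sub_cancel, mul_assoc, pow_succ]
    push_cast at this
    rw [div_eq_div_iff (by positivity) (by positivity)]
    refine mul_left_cancel₀ ht.ne' ?_
    linear_combination t ^ m * t ^ m * this - besselJ m t * t ^ m * hp
  obtain ⟨z, hz, h0⟩ := exists_hasDerivAt_eq_zero hxy
    (fun t ht => (hd t (hx.trans_le ht.1)).continuousAt.continuousWithinAt)
    (by rw [h₁, h₂]; simp) fun t ht => hd t (hx.trans ht.1)
  have hz0 : z ^ m ≠ 0 := pow_ne_zero _ (hx.trans hz.1).ne'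
  exact ⟨z, hz.1, hz.2, neg_eq_zero.1 ((div_eq_zero_iff.1 h0).resolve_right hz0)⟩

theorem exists_root_besselJ_nat_gt (m : ℕ) (a : ℝ) : ∃ x, a < x ∧ besselJ m x = 0 := by
  induction m generalizing a with
  | zero =>
    obtain ⟨x, hx, h0⟩ := exists_root_besselJ_zero (c := max a 0 + 1) (by positivity)
    exact ⟨x, by linarith [hx.1, le_max_left a 0], h0⟩
  | succ m ih =>
    obtain ⟨x, hx, h₁⟩ := ih (max a 0)
    obtain ⟨y, hy, h₂⟩ := ih x
    obtain ⟨z, hz, -, h0⟩ :=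
      exists_root_besselJ_succ_between m ((le_max_right a 0).trans_lt hx) hy h₁ h₂
    exact ⟨z, ((le_max_left a 0).trans_lt hx).trans hz, by push_cast; exact h0⟩

theorem exists_root_besselJ_gt (n : ℤ) (a : ℝ) : ∃ x, a < x ∧ besselJ n x = 0 := by
  obtain ⟨m, rfl | rfl⟩ := n.eq_nat_or_neg
  · exact exists_root_besselJ_nat_gt m a
  · simp only [besselJ_neg_eq_zero_iff]
    exact exists_root_besselJ_nat_gt m a

/-! ### The enumeration of the roots -/

/-- A zero of a function with nonzero derivative is isolated, so the infimum of the larger roots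
is attained; near `0` this role is played by the absence of roots in `(0, 1]`. -/
theorem sInf_roots_besselJ_mem (n : ℤ) {a : ℝ} (ha : a = 0 ∨ 0 < a ∧ besselJ n a = 0) :
    sInf {x : ℝ | a < x ∧ besselJ n x = 0} ∈ {x : ℝ | a < x ∧ besselJ n x = 0} := by
  obtain ⟨b, hab, hb⟩ : ∃ b, a < b ∧ ∀ x, a < x → x < b → besselJ n x ≠ 0 := by
    rcases ha with rfl | ⟨ha, h0⟩
    · exact ⟨1, one_pos, fun x hx hx1 h => (one_lt_of_root hx h).not_gt hx1⟩
    · have h := (differentiable_besselJ n a).hasDerivAt.eventually_ne (c := 0)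
        (deriv_besselJ_ne_zero_of_root ha h0)
      have h' := h.filter_mono (nhdsWithin_mono a fun x (hx : a < x) => hx.ne')
      obtain ⟨b, hb, hs⟩ := (mem_nhdsGT_iff_exists_Ioo_subset).1 h'
      exact ⟨b, hb, fun x hx hxb => hs ⟨hx, hxb⟩⟩
  have e : {x : ℝ | a < x ∧ besselJ n x = 0} = Set.Ici b ∩ besselJ n ⁻¹' {0} := by
    ext x
    refine ⟨fun ⟨h₁, h₂⟩ => ⟨not_lt.1 fun h => hb x h₁ h h₂, h₂⟩, fun ⟨h₁, h₂⟩ =>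
      ⟨hab.trans_le h₁, h₂⟩⟩
  have hclosed : IsClosed {x : ℝ | a < x ∧ besselJ n x = 0} := by
    rw [e]
    exact isClosed_Ici.inter (isClosed_singleton.preimage (continuous_besselJ n))
  exact hclosed.csInf_mem (exists_root_besselJ_gt n a) ⟨a, fun x hx => hx.1.le⟩

theorem besselRoot_succ_pos_and_root (n : ℤ) (k : ℕ) :
    0 < besselRoot n (k + 1) ∧ besselJ n (besselRoot n (k + 1)) = 0 := by
  induction k with
  | zero => exact sInf_roots_besselJ_mem n (Or.inl rfl)
  | succ k ih =>
    have h := sInf_roots_besselJ_mem n (Or.inr ih)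
    exact ⟨ih.1.trans h.1, h.2⟩

/-! ### The norm of a disk harmonic -/

theorem integral_mul_sq_besselJ_of_root {n : ℤ} {l : ℝ} (hl : l ≠ 0) (h : besselJ n l = 0) :
    ∫ r in (0 : ℝ)..1, r * besselJ n (l * r) ^ 2 = besselJ (n + 1) l ^ 2 / 2 := by
  have hd : ∀ r ∈ Set.uIcc (0 : ℝ) 1, HasDerivAt (fun r => besselEnergy n (l * r) / l ^ 2)
      (r * besselJ n (l * r) ^ 2) r := by
    intro r _
    have hlin : HasDerivAt (fun r : ℝ => l * r) l r := by
      simpa using (hasDerivAt_id r).const_mul l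
    refine (((hasDerivAt_besselEnergy n (l * r)).comp r hlin).div_const (l ^ 2)).congr_deriv ?_
    field_simp
  have hc := continuous_besselJ n
  rw [intervalIntegral.integral_eq_sub_of_hasDerivAt hd
    (Continuous.intervalIntegrable (by fun_prop) _ _), mul_one, mul_zero, besselEnergy_zero,
    besselEnergy_of_root h]
  field_simp
  ring

theorem sq_norm_diskHarmonic (n : ℤ) (k : ℕ) (z : ℂ) :
    ‖diskHarmonic n k z‖ ^ 2 = (Set.Iio (1 : ℝ)).indicator
      (fun r => normConst n k ^ 2 * besselJ n (besselRoot n k * r) ^ 2) ‖z‖ := by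
  rw [diskHarmonic]
  by_cases hz : ‖z‖ < 1
  · rw [Set.indicator_of_mem (by simpa using hz), Set.indicator_of_mem (by simpa using hz)]
    have he : ‖Complex.exp (Complex.I * n * z.arg)‖ = 1 := by
      have := Complex.norm_exp_ofReal_mul_I (n * z.arg)
      rw [← this]
      congr 2
      push_cast; ring
    rw [norm_mul, norm_mul, he, Complex.norm_real, Complex.norm_real, mul_one, mul_pow,
      Real.norm_eq_abs, Real.norm_eq_abs, sq_abs, sq_abs]
  · rw [Set.indicator_of_notMem (by simpa using hz), Set.indicator_of_notMem (by simpa using hz)]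
    simp

theorem lintegral_sq_diskHarmonic {n : ℤ} {k : ℕ} (hpos : 0 < besselRoot n k)
    (h0 : besselJ n (besselRoot n k) = 0) :
    ∫⁻ z, ‖diskHarmonic n k z‖ₑ ^ 2 = 1 := by
  set l := besselRoot n k with hl
  set g : ℝ → ℝ := fun r => normConst n k ^ 2 * besselJ n (l * r) ^ 2 with hg
  have hc : Continuous g := by
    have := continuous_besselJ n
    fun_prop
  have hJ : besselJ (n + 1) l ≠ 0 := by
    have := deriv_besselJ_ne_zero_of_root hpos h0
    rwa [deriv_besselJ_of_root hpos.ne' h0, neg_ne_zero] at this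
  have hi : ∀ r : ℝ, r ^ (Module.finrank ℝ ℂ - 1) • (Set.Iio (1 : ℝ)).indicator g r =
      (Set.Iio (1 : ℝ)).indicator (fun r => r * g r) r := by
    intro r
    rw [Complex.finrank_real_complex, Set.indicator_apply, Set.indicator_apply]
    split_ifs <;> simp
  have hint : Integrable fun z : ℂ => (Set.Iio (1 : ℝ)).indicator g ‖z‖ := by
    rw [integrable_fun_norm_addHaar]
    simp_rw [hi]
    rw [IntegrableOn, integrable_indicator_iff measurableSet_Iio, IntegrableOn,
      Measure.restrict_restrict measurableSet_Iio, Set.inter_comm, Set.Ioi_inter_Iio]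
    exact ((continuous_id.mul hc).integrableOn_Icc (a := 0) (b := 1)).mono_set
      Set.Ioo_subset_Icc_self
  have hval : ∫ z : ℂ, (Set.Iio (1 : ℝ)).indicator g ‖z‖ = 1 := by
    rw [integral_fun_norm_addHaar]
    simp_rw [hi]
    rw [setIntegral_indicator measurableSet_Iio, Set.Ioi_inter_Iio, ← integral_Ioc_eq_integral_Ioo,
      ← intervalIntegral.integral_of_le zero_le_one]
    have e : ∀ r : ℝ, r * g r = normConst n k ^ 2 * (r * besselJ n (l * r) ^ 2) := by
      intro r
      rw [hg]
      ring
    simp_rw [e]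
    rw [intervalIntegral.integral_const_mul, integral_mul_sq_besselJ_of_root hpos.ne' h0,
      Complex.finrank_real_complex, Measure.real, Complex.volume_ball, normConst, ← hl]
    have hpi := Real.pi_pos
    simp only [ENNReal.ofReal_one, one_pow, one_mul, ENNReal.coe_toReal, NNReal.coe_real_pi,
      nsmul_eq_mul, smul_eq_mul, div_pow, mul_pow, sq_abs, Real.sq_sqrt hpi.le]
    push_cast
    field_simp
  have hn : ∀ z : ℂ, ‖diskHarmonic n k z‖ₑ ^ 2 =
      ENNReal.ofReal ((Set.Iio (1 : ℝ)).indicator g ‖z‖) := by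
    intro z
    rw [← sq_norm_diskHarmonic, ENNReal.ofReal_pow (norm_nonneg _), ofReal_norm]
  simp_rw [hn]
  rw [← ofReal_integral_eq_lintegral_ofReal hint, hval, ENNReal.ofReal_one]
  refine Filter.Eventually.of_forall fun z => ?_
  change 0 ≤ (Set.Iio (1 : ℝ)).indicator g ‖z‖
  rw [← sq_norm_diskHarmonic]
  positivity

theorem eLpNorm_diskHarmonic {n : ℤ} {k : ℕ} (hpos : 0 < besselRoot n k)
    (h0 : besselJ n (besselRoot n k) = 0) :
    eLpNorm (diskHarmonic n k) 2 volume = 1 := by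
  rw [eLpNorm_eq_lintegral_rpow_enorm_toReal (by norm_num) (by norm_num)]
  simp only [ENNReal.toReal_ofNat, ENNReal.rpow_ofNat]
  rw [lintegral_sq_diskHarmonic hpos h0, ENNReal.one_rpow]

theorem normConst_eq_of_root {n : ℤ} {k : ℕ} (hpos : 0 < besselRoot n k)
    (h0 : besselJ n (besselRoot n k) = 0) :
    normConst n k = 1 / (√Real.pi * |deriv (besselJ n) (besselRoot n k)|) := by
  rw [normConst, deriv_besselJ_of_root hpos.ne' h0, abs_neg]

/-- With `λ² ≤ π p` this is the bound `λ² J_n'(λ)² ≥ 1 / 2`, since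
`c² = 1 / (π J_n'(λ)²) ≤ 2 λ² / π`. -/
theorem abs_normConst_le {n : ℤ} {k : ℕ} (hpos : 0 < besselRoot n k)
    (h0 : besselJ n (besselRoot n k) = 0) {p : ℝ} (hp : besselRoot n k ≤ √(Real.pi * p)) :
    |normConst n k| ≤ √(2 * p) := by
  have hpi := Real.pi_pos
  have hb := half_le_sq_mul_sq_deriv_of_root hpos h0
  have hD : 0 < deriv (besselJ n) (besselRoot n k) ^ 2 := by
    have := deriv_besselJ_ne_zero_of_root hpos h0
    positivity
  have hl : besselRoot n k ^ 2 ≤ Real.pi * p := by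
    rwa [Real.le_sqrt' hpos] at hp
  refine Real.abs_le_sqrt ?_
  rw [normConst_eq_of_root hpos h0, div_pow, mul_pow, sq_abs, Real.sq_sqrt hpi.le, one_pow,
    div_le_iff₀ (by positivity)]
  linarith [mul_le_mul_of_nonneg_right hl hD.le]

theorem mainTheorem6 (n : ℤ) (k : ℕ) (hk : 1 ≤ k) :
    eLpNorm (diskHarmonic n k) 2 volume = 1 ∧
    deriv (besselJ n) (besselRoot n k) ≠ 0 ∧
    normConst n k = 1 / (√Real.pi * |deriv (besselJ n) (besselRoot n k)|) ∧
    ∀ p : ℕ, besselRoot n k ≤ √(Real.pi * p) → |normConst n k| ≤ √(2 * p) := by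
  obtain ⟨k, rfl⟩ := Nat.exists_eq_add_of_le' hk
  obtain ⟨hpos, h0⟩ := besselRoot_succ_pos_and_root n k
  exact ⟨eLpNorm_diskHarmonic hpos h0, deriv_besselJ_ne_zero_of_root hpos h0,
    normConst_eq_of_root hpos h0, fun p hp => abs_normConst_le hpos h0 hp⟩
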